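/- Let $S=\mathbb{C}[x,y,z]$, let $d\ge 3$, and let $f\in S$ be a homogeneous polynomial of degree $d$ without multiple factors, so that $C: f=0$ is a reduced curve of degree $d$ in $\mathbb{P}^2$. Let $$AR(f)=\{(a,b,c)\in S^3 : a f_x+b f_y+c f_z=0\}$$ be the graded $S$-module of Jacobian syzygies of $f$, where $(a,b,c)$ is homogeneous of degree $k$ if $a,b,c$ are homogeneous polynomials of degree $k$. Suppose that $C$ is an $m$-syzygy curve with exponents $1\le d_1\le d_2\le\cdots\le d_m$, i.e. $AR(f)$ is generated by $m$ homogeneous syzygies $\rho_1,\dots,\rho_m$ with $\deg\rho_j=d_j$, and $m$ is the smallest possible number of homogeneous generators of $AR(f)$. Then $m\ge 2$ and $$m\le d_1+d_2-d+3\le d_1+2\le d+1 .$$ -/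

import Mathlib

namespace PlaneCurve

/-- The polynomial ring `S = ℂ[x, y, z]`. -/
abbrev S : Type := MvPolynomial (Fin 3) ℂ

/-- The module `AR(f)` of Jacobian syzygies of `f`: triples `(a, b, c)` in `S³` with
`a f_x + b f_y + c f_z = 0`. -/
noncomputable def AR (f : S) : Submodule S (Fin 3 → S) where
  carrier := {a | ∑ i, a i * MvPolynomial.pderiv i f = 0}
  zero_mem' := by simp
  add_mem' := by
    intro a b ha hb
    simp only [Set.mem_ofPred_eq, Pi.add_apply, add_mul, Finset.sum_add_distrib] at *
    rw [ha, hb, add_zero]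
  smul_mem' := by
    intro c a ha
    simp only [Set.mem_ofPred_eq, Pi.smul_apply, smul_eq_mul, mul_assoc] at *
    rw [← Finset.mul_sum, ha, mul_zero]

/-- The family `ρ` consists of homogeneous triples, `ρ j` of degree `e j` (all three components
are homogeneous polynomials of that degree), and it generates the `S`-module `AR(f)`. -/
structure HomogeneousGenerators (f : S) {m : ℕ} (ρ : Fin m → Fin 3 → S) (e : Fin m → ℕ) :
    Prop where
  homogeneous : ∀ j i, (ρ j i).IsHomogeneous (e j)
  span_eq : Submodule.span S (Set.range ρ) = AR f

/-- `f = 0` is an `m`-syzygy curve with exponents `e 0 ≤ e 1 ≤ ⋯ ≤ e (m - 1)`: the module `AR(f)`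
is generated by `m` homogeneous syzygies of these degrees, and it is not generated by fewer than
`m` homogeneous syzygies. (Minimality forces every generator to be nonzero, so that its degree is
well defined.) -/
structure IsSyzygyCurve (f : S) (m : ℕ) (e : Fin m → ℕ) : Prop where
  monotone : Monotone e
  generated : ∃ ρ : Fin m → Fin 3 → S, HomogeneousGenerators f ρ e
  minimal : ∀ (n : ℕ) (ρ : Fin n → Fin 3 → S) (e' : Fin n → ℕ),
    HomogeneousGenerators f ρ e' → m ≤ n

end PlaneCurve

open MvPolynomial Matrix

/-! Two syzygies are both orthogonal to the gradient of `f`, which is primitive because `f` is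
squarefree (`isUnit_of_forall_dvd_pderiv`). Hence `ρ₁ × σ = w ∇f` with `w` a polynomial. A generator
`ρ₁` of least degree is primitive too, so `σ ↦ w` has kernel `S ρ₁` and identifies `AR(f) / S ρ₁`
with an ideal `I` (`crossIdeal`). This ideal is saturated, and `σ = ρ₂` gives it a nonzero form of
degree `s = d₁ + d₂ - (d - 1)`.

Dubreil's argument (`exists_generators_modulo_linear_form`) generates `I` by `s + 1` elements modulo
`ℓ I` for a suitable linear form `ℓ`. Adding `ρ₁` and applying Nakayama gives `m ≤ s + 2 = d₁ + d₂ -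
d + 3`. The remaining inequalities follow from `d₁ ≤ d₂ ≤ d - 1`: the Koszul syzygies, of degree `d
- 1`, are not all multiples of one vector. -/

theorem exists_eq_smul_of_forall_mul_eq {R ι : Type*} [CommRing R] [IsDomain R]
    [UniqueFactorizationMonoid R] [Finite ι] {a b : ι → R}
    (hb : ∀ g, (∀ i, g ∣ b i) → IsUnit g) (hb0 : b ≠ 0) (h : ∀ i j, a i * b j = a j * b i) :
    ∃ c : R, a = c • b := by
  classical
  have := Fintype.ofFinite ι
  let _ : StrongNormalizationMonoid R := UniqueFactorizationMonoid.strongNormalizationMonoid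
  let _ : NormalizedGCDMonoid R := UniqueFactorizationMonoid.toNormalizedGCDMonoid R
  obtain ⟨k, hk⟩ := Function.ne_iff.1 hb0
  have hu : IsUnit (Finset.univ.gcd b) := hb _ fun i => Finset.gcd_dvd (Finset.mem_univ i)
  have hdvd : b k ∣ a k * Finset.univ.gcd b := by
    have h1 : b k ∣ Finset.univ.gcd fun i => a k * b i :=
      Finset.dvd_gcd fun i _ => ⟨a i, by rw [← h i k, mul_comm]⟩
    exact h1.trans (Finset.gcd_mul_left' _ _ _).dvd
  obtain ⟨c, hc⟩ := hu.dvd_mul_right.1 hdvd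
  refine ⟨c, funext fun i => mul_right_cancel₀ hk ?_⟩
  rw [h i k, hc, Pi.smul_apply, smul_eq_mul]
  ring

theorem exists_eq_smul_of_cross_eq_zero {R : Type*} [CommRing R] [IsDomain R]
    [UniqueFactorizationMonoid R] {a b : Fin 3 → R}
    (hb : ∀ g, (∀ i, g ∣ b i) → IsUnit g) (hb0 : b ≠ 0) (h : b ⨯₃ a = 0) :
    ∃ c : R, a = c • b := by
  refine exists_eq_smul_of_forall_mul_eq hb hb0 ?_
  rw [cross_apply] at h
  have h0 := congrFun h 0
  have h1 := congrFun h 1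
  have h2 := congrFun h 2
  simp at h0 h1 h2
  intro i j
  fin_cases i <;> fin_cases j <;> simp <;> grind

/-! ### Homogeneous components and primitivity of the gradient -/

namespace MvPolynomial

variable {σ R : Type*} [CommSemiring R]

theorem homogeneousComponent_mul_of_isHomogeneous {p q : MvPolynomial σ R} {e : ℕ}
    (hq : q.IsHomogeneous e) (n : ℕ) :
    homogeneousComponent n (p * q) =
      if e ≤ n then homogeneousComponent (n - e) p * q else 0 := by
  classical
  conv_lhs => rw [← sum_homogeneousComponent p, Finset.sum_mul, map_sum]
  have hmem (k : ℕ) : homogeneousComponent k p * q ∈ homogeneousSubmodule σ R (k + e) :=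
    (homogeneousComponent_isHomogeneous k p).mul hq
  simp_rw [homogeneousComponent_of_mem (hmem _)]
  split_ifs with h
  · rw [Finset.sum_eq_single (n - e)]
    · rw [if_pos (by omega)]
    · intro k _ hk
      rw [if_neg (by omega)]
    · intro hk
      rw [homogeneousComponent_eq_zero _ _ (by simp at hk; omega), zero_mul, ite_self]
  · exact Finset.sum_eq_zero fun k _ => if_neg (by omega)

theorem eq_zero_of_forall_homogeneousComponent_eq_zero {p : MvPolynomial σ R}
    (h : ∀ n, homogeneousComponent n p = 0) : p = 0 := by
  rw [← sum_homogeneousComponent p]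
  exact Finset.sum_eq_zero fun n _ => h n

theorem isUnit_of_totalDegree_eq_zero {σ K : Type*} [Field K] {p : MvPolynomial σ K}
    (hp : p ≠ 0) (h : p.totalDegree = 0) : IsUnit p := by
  rw [totalDegree_eq_zero_iff_eq_C] at h
  rw [h] at hp ⊢
  exact (isUnit_iff_ne_zero.2 fun h0 => hp (by rw [h0, C_0])).map C

theorem totalDegree_pderiv_lt {σ R : Type*} [CommSemiring R] {p : MvPolynomial σ R} {i : σ}
    (h : pderiv i p ≠ 0) : (pderiv i p).totalDegree < p.totalDegree := by
  classical
  rw [totalDegree, Finset.sup_lt_iff]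
  · intro m hm
    rw [mem_support_iff, coeff_pderiv] at hm
    have h1 := le_totalDegree (mem_support_iff.2 (left_ne_zero_of_mul hm))
    rw [Finsupp.sum_add_index' (by simp) (by simp), Finsupp.sum_single_index rfl] at h1
    omega
  · obtain ⟨m, hm⟩ := ne_zero_iff.1 h
    rw [coeff_pderiv] at hm
    have h1 := le_totalDegree (mem_support_iff.2 (left_ne_zero_of_mul hm))
    rw [Finsupp.sum_add_index' (by simp) (by simp), Finsupp.sum_single_index rfl] at h1
    rw [bot_eq_zero']
    omega

theorem eq_C_of_forall_pderiv_eq_zero {σ K : Type*} [Field K] [CharZero K]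
    {p : MvPolynomial σ K} (h : ∀ i, pderiv i p = 0) : p = C (coeff 0 p) := by
  classical
  ext m
  rw [coeff_C]
  split_ifs with hm
  · rw [hm]
  · obtain ⟨i, hi⟩ := Finsupp.ne_iff.1 (Ne.symm hm)
    have hle : Finsupp.single i 1 ≤ m :=
      Finsupp.single_le_iff.2 (Nat.one_le_iff_ne_zero.2 (by simpa using hi))
    have h1 := coeff_pderiv (i := i) p (m - Finsupp.single i 1)
    rw [h i, coeff_zero, tsub_add_cancel_of_le hle] at h1
    exact (mul_eq_zero.1 h1.symm).resolve_right (Nat.cast_add_one_ne_zero _)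

/-- By Euler's formula `g` divides `f`. An irreducible factor `p` of `g` divides `f = p q` but not
`q`, so it divides its own partial derivatives; by degree these vanish, and `p` is constant. -/
theorem isUnit_of_forall_dvd_pderiv {σ K : Type*} [Finite σ] [Field K] [CharZero K]
    {f : MvPolynomial σ K} {d : ℕ} (hd : d ≠ 0) (hf : f.IsHomogeneous d) (hred : Squarefree f)
    {g : MvPolynomial σ K} (hg : ∀ i, g ∣ pderiv i f) : IsUnit g := by
  classical
  have := Fintype.ofFinite σ
  have hdvd : g ∣ f := by
    have hE := hf.sum_X_mul_pderiv
    have h1 : g ∣ d • f := by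
      rw [← hE]
      exact Finset.dvd_sum fun i _ => (hg i).mul_left _
    have hu : IsUnit (d : MvPolynomial σ K) := by
      have := (isUnit_iff_ne_zero.2 (Nat.cast_ne_zero.2 hd : (d : K) ≠ 0)).map
        (C : K →+* MvPolynomial σ K)
      simpa using this
    rw [nsmul_eq_mul] at h1
    exact hu.dvd_mul_left.1 h1
  by_contra hgu
  have hg0 : g ≠ 0 := fun h => hred.ne_zero (zero_dvd_iff.1 (h ▸ hdvd))
  obtain ⟨p, hp, hpg⟩ := WfDvdMonoid.exists_irreducible_factor hgu hg0
  obtain ⟨q, rfl⟩ := hpg.trans hdvd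
  have hpq : ¬ p ∣ q := by
    rintro ⟨r, rfl⟩
    exact hp.not_isUnit (hred p ⟨r, by ring⟩)
  have hpd (i : σ) : pderiv i p = 0 := by
    have h1 : p ∣ pderiv i p * q + p * pderiv i q := by
      rw [← pderiv_mul]
      exact hpg.trans (hg i)
    have h2 : p ∣ pderiv i p := by
      exact (hp.prime.dvd_mul.1 ((dvd_add_left (dvd_mul_right _ _)).1 h1)).resolve_right hpq
    by_contra hne
    exact (totalDegree_pderiv_lt hne).not_ge (totalDegree_le_of_dvd_of_isDomain h2 hne)
  have hC := eq_C_of_forall_pderiv_eq_zero hpd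
  exact hp.not_isUnit (isUnit_of_totalDegree_eq_zero hp.ne_zero (by rw [hC, totalDegree_C]))

end MvPolynomial

/-! ### Counting generators over a principal ideal domain -/

theorem Submodule.exists_fin_span_eq_of_le {R M : Type*} [CommRing R] [IsDomain R]
    [IsPrincipalIdealRing R] [AddCommGroup M] [Module R M] {s : ℕ} {N O : Submodule R M}
    (hNO : N ≤ O) (b : Module.Basis (Fin s) R O) :
    ∃ v : Fin s → M, Submodule.span R (Set.range v) = N := by
  obtain ⟨n, b'⟩ := Submodule.basisOfPidOfLE hNO b
  have hn : n ≤ s := by simpa using Module.Basis.card_le_card_of_le hNO b b'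
  -- A basis of `N` may have fewer than `s` elements; it is padded with zeros.
  refine ⟨fun i => if h : (i : ℕ) < n then b' ⟨i, h⟩ else 0, le_antisymm ?_ ?_⟩
  · rw [Submodule.span_le]
    rintro _ ⟨i, rfl⟩
    dsimp only
    split_ifs
    exacts [SetLike.coe_mem _, N.zero_mem]
  · conv_lhs => rw [← Submodule.map_subtype_top N, ← b'.span_eq, Submodule.map_span]
    rw [Submodule.span_le]
    rintro _ ⟨_, ⟨i, rfl⟩, rfl⟩
    exact Submodule.subset_span ⟨Fin.castLE hn i, by simp⟩

namespace Polynomial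

/-- Up to a unit `h` is monic of degree `s`. Remainders on division by it lie in a submodule of the
free module of rank `s` of polynomials of degree below `s`, so `s` generators suffice besides `h`.
-/
theorem exists_fin_span_eq_of_natDegree {R : Type*} [CommRing R] [IsDomain R]
    [IsPrincipalIdealRing R] {s : ℕ} (J : Ideal R[X]) {h : R[X]} (hJ : h ∈ J)
    (hdeg : h.natDegree ≤ s) (hcoeff : IsUnit (h.coeff s)) :
    ∃ v : Fin (s + 1) → R[X], Ideal.span (Set.range v) = J := by
  obtain ⟨u, hu⟩ := hcoeff
  have hmon : (C (↑u⁻¹ : R) * h).Monic :=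
    monic_of_natDegree_le_of_coeff_eq_one s ((natDegree_C_mul_le _ _).trans hdeg) (by simp [← hu])
  set q := C (↑u⁻¹ : R) * h with hq
  have hqJ : q ∈ J := J.mul_mem_left _ hJ
  have hqdeg : q.natDegree ≤ s := (natDegree_C_mul_le _ _).trans hdeg
  obtain ⟨v, hv⟩ := Submodule.exists_fin_span_eq_of_le
    (N := J.restrictScalars R ⊓ degreeLT R s) inf_le_right
    ((Pi.basisFun R (Fin s)).map (degreeLTEquiv R s).symm)
  refine ⟨Fin.cons q v, le_antisymm (Ideal.span_le.2 ?_) fun p hp => ?_⟩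
  · rintro _ ⟨i, rfl⟩
    refine Fin.cases hqJ (fun i => ?_) i
    have : v i ∈ J.restrictScalars R ⊓ degreeLT R s := hv ▸ Submodule.subset_span ⟨i, rfl⟩
    exact this.1
  · have hr : p %ₘ q ∈ J.restrictScalars R ⊓ degreeLT R s := by
      refine ⟨?_, mem_degreeLT.2 ?_⟩
      · rw [modByMonic_eq_sub_mul_div]
        exact J.sub_mem hp (J.mul_mem_right _ hqJ)
      · exact (degree_modByMonic_lt p hmon).trans_le (degree_le_of_natDegree_le hqdeg)
    rw [← hv] at hr
    rw [← modByMonic_add_div p q]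
    refine Ideal.add_mem _ ?_ (Ideal.mul_mem_right _ _ (Ideal.subset_span ⟨0, rfl⟩))
    have hle : Submodule.span R (Set.range v) ≤
        (Ideal.span (Set.range (Fin.cons q v : Fin (s + 1) → R[X]))).restrictScalars R := by
      rw [Submodule.span_le]
      rintro _ ⟨i, rfl⟩
      exact Ideal.subset_span ⟨i.succ, rfl⟩
    exact hle hr

end Polynomial

/-! ### Dubreil's bound modulo a linear form -/

namespace MvPolynomial

theorem natDegree_aeval_le_and_coeff {σ K R : Type*} [CommSemiring K] [CommSemiring R]
    [Algebra K R] {h : MvPolynomial σ K} {s : ℕ} (hh : h.IsHomogeneous s) (q p : σ → R) :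
    (aeval (fun j => Polynomial.C (q j) + Polynomial.C (p j) * Polynomial.X) h).natDegree ≤ s ∧
    (aeval (fun j => Polynomial.C (q j) + Polynomial.C (p j) * Polynomial.X) h).coeff s =
      aeval p h := by
  have hmon (m : σ →₀ ℕ) :
      (m.prod fun j k => (Polynomial.C (q j) + Polynomial.C (p j) * Polynomial.X) ^ k).natDegree ≤
        m.degree ∧
      (m.prod fun j k => (Polynomial.C (q j) + Polynomial.C (p j) * Polynomial.X) ^ k).coeff
        m.degree = m.prod fun j k => p j ^ k := by
    classical
    induction m using Finsupp.induction_linear with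
    | zero => simp
    | add m n hm hn =>
      rw [Finsupp.prod_add_index' (by simp) (by simp [pow_add]),
        Finsupp.prod_add_index' (by simp) (by simp [pow_add]), map_add]
      exact ⟨Polynomial.natDegree_mul_le_of_le hm.1 hn.1, by
        rw [Polynomial.coeff_mul_add_eq_of_natDegree_le hm.1 hn.1, hm.2, hn.2]⟩
    | single j k =>
      have h1 : (Polynomial.C (q j) + Polynomial.C (p j) * Polynomial.X).natDegree ≤ 1 := by
        compute_degree
      rw [Finsupp.prod_single_index (by simp), Finsupp.prod_single_index (by simp),
        Finsupp.degree_single]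
      refine ⟨(Polynomial.natDegree_pow_le_of_le k h1).trans_eq (mul_one k), ?_⟩
      have := Polynomial.coeff_pow_of_natDegree_le h1 (m := k)
      simpa using this
  have hdeg {m : σ →₀ ℕ} (hm : m ∈ h.support) : m.degree = s := by
    rw [← hh (mem_support_iff.1 hm), Finsupp.degree_eq_weight_one]
    rfl
  simp only [aeval_def, eval₂_eq, Polynomial.finsetSum_coeff]
  constructor
  · refine Polynomial.natDegree_sum_le_of_forall_le _ _ fun m hm => ?_
    rw [← hdeg hm]
    exact (Polynomial.natDegree_C_mul_le _ _).trans (hmon m).1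
  · refine Finset.sum_congr rfl fun m hm => ?_
    have := (hmon m).2
    rw [hdeg hm] at this
    exact (Polynomial.coeff_C_mul _).trans (congrArg _ this)

end MvPolynomial

namespace MvPolynomial

theorem aeval_mul_right_of_isHomogeneous {σ K R : Type*} [CommSemiring K] [CommSemiring R]
    [Algebra K R] {h : MvPolynomial σ K} {s : ℕ} (hh : h.IsHomogeneous s) (r : σ → R) (x : R) :
    aeval (fun j => r j * x) h = aeval r h * x ^ s := by
  rw [aeval_def, aeval_def, eval₂_eq, eval₂_eq, Finset.sum_mul]
  refine Finset.sum_congr rfl fun m hm => ?_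
  have hs : ∑ i ∈ m.support, m i = s := by
    rw [← hh (mem_support_iff.1 hm), Pi.one_def, ← Finsupp.degree_eq_weight_one]
    rfl
  simp_rw [mul_pow, Finset.prod_mul_distrib, Finset.prod_pow_eq_pow_sum, hs]
  ring

/-- Prime avoidance in the pencil of lines through a point off `h = 0`. An associated prime
containing two of the lines contains all linear forms vanishing at the point; modulo it `h` is a
nonzero constant times `X 0 ^ s`, so it contains every variable, against saturation. Each of the
finitely many associated primes thus excludes at most one `t`. -/
theorem exists_regular_linear_form {K : Type*} [Field K] [Infinite K]
    {I : Ideal (MvPolynomial (Fin 3) K)} {h : MvPolynomial (Fin 3) K} {s : ℕ}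
    (hI : h ∈ I) (hh : h.IsHomogeneous s)
    (hsat : ∀ w, (∀ i, X i * w ∈ I) → w ∈ I) {b c : K} (hp : eval ![1, b, c] h ≠ 0) :
    ∃ t : K, ∀ w, (X 2 - C c * X 0 - C t * (X 1 - C b * X 0)) * w ∈ I → w ∈ I := by
  set ℓ : K → MvPolynomial (Fin 3) K := fun t => X 2 - C c * X 0 - C t * (X 1 - C b * X 0) with hℓ
  have huniq : ∀ P ∈ associatedPrimes (MvPolynomial (Fin 3) K) (MvPolynomial (Fin 3) K ⧸ I),
      ∀ t t', ℓ t ∈ P → ℓ t' ∈ P → t = t' := by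
    intro P hP t t' ht ht'
    by_contra hne
    obtain ⟨hprime, x, hx⟩ := isAssociatedPrime_iff.1 (AssociatedPrimes.mem_iff.1 hP)
    obtain ⟨w, rfl⟩ := Ideal.Quotient.mk_surjective x
    have hmem (g : MvPolynomial (Fin 3) K) : g ∈ P ↔ g * w ∈ I := by
      rw [hx, Submodule.mem_colon_singleton, Submodule.mem_bot, ← Ideal.Quotient.eq_zero_iff_mem]
      rfl
    have hIP : I ≤ P := fun g hg => (hmem g).2 (I.mul_mem_right _ hg)
    have h1 : X 1 - C b * X 0 ∈ P := by
      have h2 : C (t' - t) * (X 1 - C b * X 0) ∈ P := by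
        have := P.sub_mem ht ht'
        convert! this using 1
        simp only [hℓ, C_sub]
        ring
      have h3 := P.mul_mem_left (C (t' - t)⁻¹) h2
      rwa [← mul_assoc, ← C_mul, inv_mul_cancel₀ (sub_ne_zero.2 (Ne.symm hne)), C_1,
        one_mul] at h3
    have h2 : X 2 - C c * X 0 ∈ P := by
      have := P.add_mem ht (P.mul_mem_left (C t) h1)
      simpa [hℓ] using this
    have h0 : X 0 ∈ P := by
      have e : Ideal.Quotient.mkₐ K P = aeval (fun j =>
          algebraMap K (MvPolynomial (Fin 3) K ⧸ P) ((![1, b, c] : Fin 3 → K) j) *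
            Ideal.Quotient.mk P (X 0)) := by
        ext j
        rw [aeval_X]
        fin_cases j
        · simp
        · exact (Ideal.Quotient.mk_eq_mk_iff_sub_mem _ _).2 h1
        · exact (Ideal.Quotient.mk_eq_mk_iff_sub_mem _ _).2 h2
      have h3 := DFunLike.congr_fun e h
      rw [aeval_mul_right_of_isHomogeneous hh] at h3
      have h4 : Ideal.Quotient.mkₐ K P h = 0 := Ideal.Quotient.eq_zero_iff_mem.2 (hIP hI)
      have h5 : aeval (fun j => algebraMap K (MvPolynomial (Fin 3) K ⧸ P)
          ((![1, b, c] : Fin 3 → K) j)) h = algebraMap K _ (eval ![1, b, c] h) := by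
        rw [← aeval_eq_eval]
        exact aeval_algebraMap_apply _ _ _
      rw [h4, h5] at h3
      have := hprime
      have h6 := (mul_eq_zero.1 h3.symm).resolve_left
        (by simpa using hp)
      exact Ideal.Quotient.eq_zero_iff_mem.1 (eq_zero_of_pow_eq_zero h6)
    have hw : w ∈ I := hsat w fun i => (hmem _).1 <| by
      fin_cases i
      · exact h0
      · simpa using P.add_mem h1 (P.mul_mem_left (C b) h0)
      · simpa using P.add_mem h2 (P.mul_mem_left (C c) h0)
    exact hprime.ne_top ((Ideal.eq_top_iff_one _).2 ((hmem 1).2 (by simpa using hw)))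
  have hfin : (⋃ P ∈ associatedPrimes (MvPolynomial (Fin 3) K) (MvPolynomial (Fin 3) K ⧸ I),
      {t | ℓ t ∈ P}).Finite :=
    (associatedPrimes.finite _ _).biUnion fun P hP =>
      Set.Subsingleton.finite fun t ht t' ht' => huniq P hP t t' ht ht'
  obtain ⟨t, ht⟩ := hfin.infinite_compl.nonempty
  refine ⟨t, fun w hw => by_contra fun hwI => ht ?_⟩
  have hz : ℓ t ∈ ⋃ P ∈ associatedPrimes (MvPolynomial (Fin 3) K) (MvPolynomial (Fin 3) K ⧸ I),
      (P : Set (MvPolynomial (Fin 3) K)) := by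
    rw [biUnion_associatedPrimes_eq_zero_divisors]
    exact ⟨Ideal.Quotient.mk I w, fun h => hwI (Ideal.Quotient.eq_zero_iff_mem.1 h),
      Ideal.Quotient.eq_zero_iff_mem.2 hw⟩
  simpa using hz

/-- A homogeneous version of Dubreil's bound on the number of generators of a perfect ideal of
codimension two: modulo a linear form, `s + 1` elements generate. -/
theorem exists_generators_modulo_linear_form {K : Type*} [Field K] [Infinite K]
    {I : Ideal (MvPolynomial (Fin 3) K)} {h : MvPolynomial (Fin 3) K} {s : ℕ}
    (hI : h ∈ I) (hh : h.IsHomogeneous s) (h0 : h ≠ 0)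
    (hsat : ∀ w, (∀ i, X i * w ∈ I) → w ∈ I) :
    ∃ (v : Fin (s + 1) → MvPolynomial (Fin 3) K) (ℓ : MvPolynomial (Fin 3) K),
      (∀ i, v i ∈ I) ∧ constantCoeff ℓ = 0 ∧
      ∀ w ∈ I, ∃ (c : Fin (s + 1) → MvPolynomial (Fin 3) K) (w' : MvPolynomial (Fin 3) K),
        w' ∈ I ∧ w = ∑ i, c i * v i + ℓ * w' := by
  obtain ⟨b, c, hp⟩ : ∃ b c : K, eval ![1, b, c] h ≠ 0 := by
    obtain ⟨p, hp⟩ : ∃ p, eval p (h * X 0) ≠ 0 := by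
      by_contra! hall
      exact mul_ne_zero h0 (X_ne_zero 0) (MvPolynomial.funext (by simpa using hall))
    rw [map_mul, eval_X] at hp
    refine ⟨p 1 / p 0, p 2 / p 0, fun h1 => left_ne_zero_of_mul hp ?_⟩
    have h2 := aeval_mul_right_of_isHomogeneous hh ![1, p 1 / p 0, p 2 / p 0] (p 0)
    have h3 : (fun j => (![1, p 1 / p 0, p 2 / p 0] : Fin 3 → K) j * p 0) = p := by
      have := right_ne_zero_of_mul hp
      ext j
      fin_cases j <;> simp [this]
    rw [h3, aeval_eq_eval, aeval_eq_eval, h1, zero_mul] at h2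
    exact h2
  obtain ⟨t, ht⟩ := exists_regular_linear_form hI hh hsat hp
  set ℓ : MvPolynomial (Fin 3) K := X 2 - C c * X 0 - C t * (X 1 - C b * X 0) with hℓ
  -- Restriction to the line `ℓ = 0`, with `X 0` as outer variable and `X 1 - b X 0` as inner one;
  -- `α` is a section. The leading coefficient of `θ h` in the outer variable is the nonzero
  -- constant `h(1, b, c)`.
  let θ : MvPolynomial (Fin 3) K →ₐ[K] Polynomial (Polynomial K) := aeval fun j =>
    Polynomial.C ((![0, Polynomial.X, Polynomial.C t * Polynomial.X] : Fin 3 → Polynomial K) j) +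
      Polynomial.C (Polynomial.C ((![1, b, c] : Fin 3 → K) j)) * Polynomial.X
  let α : Polynomial (Polynomial K) →+* MvPolynomial (Fin 3) K :=
    Polynomial.eval₂RingHom (Polynomial.eval₂RingHom C (X 1 - C b * X 0)) (X 0)
  have hθα (g) : θ (α g) = g := by
    have : (θ : MvPolynomial (Fin 3) K →+* _).comp α = RingHom.id _ := by
      ext
      · simp [θ, α]
      · simp [θ, α]
      · simp [θ, α]
    exact DFunLike.congr_fun this g
  have hαθ (g) : ℓ ∣ g - α (θ g) := by
    rw [← Ideal.mem_span_singleton, ← Ideal.Quotient.mk_eq_mk_iff_sub_mem]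
    have : Ideal.Quotient.mk (Ideal.span {ℓ}) = (Ideal.Quotient.mk (Ideal.span {ℓ})).comp
        (α.comp (θ : MvPolynomial (Fin 3) K →+* _)) := by
      ext j
      · simp [θ, α]
      · fin_cases j
        · simp [θ, α]
        · simp [θ, α]
        · refine (Ideal.Quotient.mk_eq_mk_iff_sub_mem _ _).2 (Ideal.mem_span_singleton'.2 ⟨1, ?_⟩)
          simp [θ, α, hℓ]
          ring
    exact DFunLike.congr_fun this g
  have hdeg := natDegree_aeval_le_and_coeff (R := Polynomial K) hh
    ![0, Polynomial.X, Polynomial.C t * Polynomial.X] fun j => Polynomial.C ((![1, b, c] : Fin 3 → K) j)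
  have hsurj : Function.Surjective θ := fun g => ⟨α g, hθα g⟩
  obtain ⟨u, hu⟩ := Polynomial.exists_fin_span_eq_of_natDegree (I.map θ)
    (Ideal.mem_map_of_mem θ hI) hdeg.1 (by
      rw [hdeg.2]
      have := aeval_algebraMap_apply (Polynomial K) ![1, b, c] h
      rw [aeval_eq_eval] at this
      refine this ▸ (isUnit_iff_ne_zero.2 hp).map _)
  have huI (i) : ∃ v ∈ I, θ v = u i :=
    (Ideal.mem_map_iff_of_surjective θ hsurj).1 (hu ▸ Ideal.subset_span ⟨i, rfl⟩)
  choose v hvI hv using huI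
  refine ⟨v, ℓ, hvI, by simp [hℓ], fun w hw => ?_⟩
  obtain ⟨c, hc⟩ := (Ideal.mem_span_range_iff_exists_fun).1
    (hu.symm ▸ Ideal.mem_map_of_mem θ hw : θ w ∈ Ideal.span (Set.range u))
  obtain ⟨w', hw'⟩ := hαθ (w - ∑ i, α (c i) * v i)
  have hz : θ (w - ∑ i, α (c i) * v i) = 0 := by
    simp [map_sub, map_sum, hθα, hv, hc]
  rw [hz, map_zero, sub_zero] at hw'
  -- Regularity of `ℓ` modulo `I` is what puts the quotient `w'` back in `I`.
  refine ⟨fun i => α (c i), w', ht w' ?_, by rw [← hw']; ring⟩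
  rw [← hw']
  exact I.sub_mem hw (I.sum_mem fun i _ => I.mul_mem_left _ (hvI i))

end MvPolynomial

/-- `X 2` is regular modulo the monomial ideal `(X 0, X 1)`. This solves the cocycle relation in the
saturation proof. -/
theorem MvPolynomial.exists_eq_add_of_X_mul_eq_add {K : Type*} [CommRing K]
    {c p q : MvPolynomial (Fin 3) K} (h : X 2 * c = X 0 * p + X 1 * q) :
    ∃ a b, c = X 0 * a + X 1 * b := by
  have key (g : MvPolynomial (Fin 3) K) :
      g ∈ Ideal.span (X '' ({0, 1} : Set (Fin 3))) ↔ ∃ a b, g = X 0 * a + X 1 * b := by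
    rw [Set.image_pair, Ideal.mem_span_pair]
    constructor
    · rintro ⟨a, b, rfl⟩
      exact ⟨a, b, by ring⟩
    · rintro ⟨a, b, rfl⟩
      exact ⟨a, b, by ring⟩
  rw [← key]
  have h1 := (key _).2 ⟨p, q, h⟩
  rw [mem_ideal_span_X_image] at h1 ⊢
  intro m hm
  obtain ⟨i, hi, hne⟩ := h1 (Finsupp.single 2 1 + m) (by
    rw [mem_support_iff, coeff_X_mul]
    exact mem_support_iff.1 hm)
  refine ⟨i, hi, ?_⟩
  rcases hi with rfl | rfl <;> simpa using hne

/-! ### Cross products of syzygies and the ideal they define -/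

namespace PlaneCurve

theorem mem_AR_iff {f : S} {a : Fin 3 → S} :
    a ∈ AR f ↔ a 0 * pderiv 0 f + a 1 * pderiv 1 f + a 2 * pderiv 2 f = 0 := by
  rw [← Fin.sum_univ_three fun i => a i * pderiv i f]
  rfl

theorem mem_AR_of_smul_mem {f g : S} {a : Fin 3 → S} (hg : g ≠ 0) (h : g • a ∈ AR f) :
    a ∈ AR f := by
  rw [mem_AR_iff] at h ⊢
  refine mul_left_cancel₀ hg ?_
  simp only [Pi.smul_apply, smul_eq_mul] at h
  linear_combination h

theorem exists_cross_eq_smul {f : S} (hf : ∀ g, (∀ i, g ∣ pderiv i f) → IsUnit g)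
    (hf0 : (fun i => pderiv i f) ≠ 0) {a b : Fin 3 → S} (ha : a ∈ AR f) (hb : b ∈ AR f) :
    ∃ w : S, a ⨯₃ b = w • fun i => pderiv i f := by
  refine exists_eq_smul_of_cross_eq_zero hf hf0 ?_
  rw [mem_AR_iff] at ha hb
  ext1 i
  fin_cases i <;> simp [cross_apply]
  · linear_combination a 0 * hb - b 0 * ha
  · linear_combination a 1 * hb - b 1 * ha
  · linear_combination a 2 * hb - b 2 * ha

/-- The ideal of all `w` such that `a × σ = w ∇f` for some Jacobian syzygy `σ`. -/
noncomputable def crossIdeal (f : S) (a : Fin 3 → S) : Ideal S where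
  carrier := {w | ∃ σ ∈ AR f, a ⨯₃ σ = w • fun i => pderiv i f}
  zero_mem' := ⟨0, Submodule.zero_mem _, by simp⟩
  add_mem' := by
    rintro v w ⟨σ, hσ, h⟩ ⟨τ, hτ, h'⟩
    exact ⟨σ + τ, Submodule.add_mem _ hσ hτ, by rw [map_add, h, h', add_smul]⟩
  smul_mem' := by
    rintro c w ⟨σ, hσ, h⟩
    exact ⟨c • σ, Submodule.smul_mem _ _ hσ, by rw [map_smul, h, smul_eq_mul, mul_smul]⟩

/-- If `σ i` realises `X i * w`, then `X j σ i - X i σ j = c_ij a`, and the `c_ij` satisfy a cocycle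
relation forcing `c₀₁ = X 0 B + X 1 A`. Then `σ 0 - A a` is divisible by `X 0`, and the quotient
realises `w`. -/
theorem mem_crossIdeal_of_forall_X_mul_mem {f : S} {a : Fin 3 → S} (ha : a ∈ AR f) (ha0 : a ≠ 0)
    (hker : ∀ σ, a ⨯₃ σ = 0 → ∃ c : S, σ = c • a) {w : S}
    (h : ∀ i, X i * w ∈ crossIdeal f a) : w ∈ crossIdeal f a := by
  choose σ hσ hcross using h
  have hrel (i j : Fin 3) : ∃ c : S, (X j : S) • σ i - (X i : S) • σ j = c • a := by
    refine hker _ ?_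
    rw [map_sub, map_smul, map_smul, hcross, hcross, smul_smul, smul_smul, ← sub_smul]
    rw [show (X j * (X i * w) - X i * (X j * w) : S) = 0 by ring, zero_smul]
  obtain ⟨c₀₁, h₀₁⟩ := hrel 0 1
  obtain ⟨c₁₂, h₁₂⟩ := hrel 1 2
  obtain ⟨c₂₀, h₂₀⟩ := hrel 2 0
  have hk : (X 2 * c₀₁ + X 0 * c₁₂ + X 1 * c₂₀ : S) • a = 0 := by
    simp only [add_smul, mul_smul, ← h₀₁, ← h₁₂, ← h₂₀]
    module
  have hk' := (smul_eq_zero.1 hk).resolve_right ha0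
  obtain ⟨B, A, rfl⟩ := exists_eq_add_of_X_mul_eq_add (c := c₀₁) (p := -c₁₂) (q := -c₂₀)
    (by linear_combination hk')
  have hdvd (i : Fin 3) : (X 0 : S) ∣ (σ 0 - A • a) i := by
    have h1 := congrFun h₀₁ i
    simp only [Pi.sub_apply, Pi.smul_apply, smul_eq_mul] at h1 ⊢
    have h2 : (X 0 : S) ∣ X 1 * (σ 0 i - A * a i) := ⟨σ 1 i + B * a i, by linear_combination h1⟩
    refine ((X_prime (R := ℂ) (i := (0 : Fin 3))).dvd_mul.1 h2).resolve_left ?_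
    rw [X_dvd_X]
    simp
  choose τ hτ using hdvd
  have hτ' : σ 0 - A • a = (X 0 : S) • τ := funext hτ
  refine ⟨τ, mem_AR_of_smul_mem (X_ne_zero 0) (hτ' ▸ sub_mem (hσ 0) (Submodule.smul_mem _ _ ha)),
    smul_right_injective _ (X_ne_zero (R := ℂ) (0 : Fin 3)) ?_⟩
  dsimp only
  rw [← map_smul, ← hτ', map_sub, map_smul, cross_self, smul_zero, sub_zero, hcross, mul_smul]

/-! ### Minimal generators and graded Nakayama -/

section Generators

variable {f : S} {m : ℕ} {ρ : Fin m → Fin 3 → S} {e : Fin m → ℕ}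

theorem HomogeneousGenerators.mem_AR (h : HomogeneousGenerators f ρ e) (j : Fin m) :
    ρ j ∈ AR f :=
  h.span_eq ▸ Submodule.subset_span ⟨j, rfl⟩

theorem HomogeneousGenerators.exists_eq_sum (h : HomogeneousGenerators f ρ e) {τ : Fin 3 → S}
    (hτ : τ ∈ AR f) : ∃ c : Fin m → S, ∑ j, c j • ρ j = τ := by
  rw [← h.span_eq] at hτ
  exact (Submodule.mem_span_range_iff_exists_fun S).1 hτ

theorem HomogeneousGenerators.homogeneousComponent_sum (h : HomogeneousGenerators f ρ e)
    (c : Fin m → S) (n : ℕ) (i : Fin 3) :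
    homogeneousComponent n ((∑ j, c j • ρ j) i) =
      ∑ j, (if e j ≤ n then homogeneousComponent (n - e j) (c j) else 0) * ρ j i := by
  simp only [Finset.sum_apply, Pi.smul_apply, smul_eq_mul, map_sum,
    homogeneousComponent_mul_of_isHomogeneous (h.homogeneous _ i), ite_mul, zero_mul]

theorem HomogeneousGenerators.constantCoeff_eq_zero (h : HomogeneousGenerators f ρ e)
    (hmin : ∀ (n : ℕ) (ρ : Fin n → Fin 3 → S) (e' : Fin n → ℕ),
      HomogeneousGenerators f ρ e' → m ≤ n)
    {c : Fin m → S} (hc : ∑ j, c j • ρ j = 0) (k : Fin m) : constantCoeff (c k) = 0 := by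
  by_contra hk
  obtain ⟨m, rfl⟩ : ∃ m', m = m' + 1 := ⟨m - 1, by have := k.pos; omega⟩
  suffices HomogeneousGenerators f (fun j => ρ (k.succAbove j)) (fun j => e (k.succAbove j)) by
    have := hmin m _ _ this
    omega
  refine ⟨fun j i => h.homogeneous _ i, le_antisymm ?_ ?_⟩
  · rw [Submodule.span_le]
    rintro _ ⟨j, rfl⟩
    exact h.mem_AR _
  rw [← h.span_eq, Submodule.span_le]
  rintro _ ⟨j, rfl⟩
  rcases Fin.eq_self_or_eq_succAbove k j with rfl | ⟨j, rfl⟩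
  swap
  · exact Submodule.subset_span ⟨j, rfl⟩
  -- Coefficients of the degree `e j` part of the relation: that of `ρ j` is a nonzero constant, so
  -- `ρ j` is redundant.
  set c' : Fin (m + 1) → S := fun l =>
    if e l ≤ e j then homogeneousComponent (e j - e l) (c l) else 0 with hc'
  have hsum : ∑ l, c' l • ρ l = 0 := by
    ext1 i
    have := h.homogeneousComponent_sum c (e j) i
    rw [hc, Pi.zero_apply, map_zero] at this
    simpa only [Finset.sum_apply, Pi.smul_apply, smul_eq_mul, Pi.zero_apply] using this.symm
  rw [Fin.sum_univ_succAbove _ j] at hsum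
  have hcj : c' j = C (constantCoeff (c j)) := by
    simp [hc', constantCoeff_eq]
  have hρ : ρ j = (C (constantCoeff (c j))⁻¹ : S) • -∑ l, c' (j.succAbove l) • ρ (j.succAbove l) := by
    rw [← eq_neg_of_add_eq_zero_left hsum, hcj, smul_smul, ← C_mul, inv_mul_cancel₀ hk, C_1,
      one_smul]
  rw [hρ]
  exact Submodule.smul_mem _ _ (Submodule.neg_mem _ (Submodule.sum_mem _ fun l _ =>
    Submodule.smul_mem _ _ (Submodule.subset_span ⟨l, rfl⟩)))

/-- Dividing by a nonunit `g` would leave a nonzero syzygy of degree below that of every generator.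
-/
theorem HomogeneousGenerators.isUnit_of_forall_dvd (h : HomogeneousGenerators f ρ e)
    {k : Fin m} (hk : ∀ j, e k ≤ e j) (h0 : ρ k ≠ 0) {g : S} (hg : ∀ i, g ∣ ρ k i) :
    IsUnit g := by
  choose τ hτ using hg
  have hτ' : ρ k = g • τ := funext hτ
  have hg0 : g ≠ 0 := by
    rintro rfl
    exact h0 (by rw [hτ', zero_smul])
  by_contra hgu
  have hdeg : 0 < g.totalDegree :=
    Nat.pos_of_ne_zero fun hd => hgu (isUnit_of_totalDegree_eq_zero hg0 hd)
  obtain ⟨c, hc⟩ := h.exists_eq_sum (mem_AR_of_smul_mem hg0 (hτ' ▸ h.mem_AR k))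
  refine h0 (hτ'.trans ?_)
  suffices τ = 0 by rw [this, smul_zero]
  ext1 i
  refine eq_zero_of_forall_homogeneousComponent_eq_zero fun n => ?_
  by_contra hn
  have hτi : τ i ≠ 0 := by
    intro hi
    exact hn (by rw [hi, map_zero])
  have hlt : (τ i).totalDegree < e k := by
    have h1 := (h.homogeneous k i).totalDegree (by rw [hτ]; exact mul_ne_zero hg0 hτi)
    rw [hτ, totalDegree_mul_of_isDomain hg0 hτi] at h1
    omega
  rcases lt_or_ge n (e k) with hnk | hnk
  · refine hn ?_
    rw [← hc, h.homogeneousComponent_sum]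
    exact Finset.sum_eq_zero fun j _ => by
      rw [if_neg (by have := hk j; omega), zero_mul]
  · exact hn (homogeneousComponent_eq_zero _ _ (hlt.trans_le hnk))

/-- Nakayama by ranks: modulo the variables, the identity matrix of size `m` factors through
dimension `n`. The `τ i` need not be homogeneous, so `hmin` does not apply to them directly. -/
theorem HomogeneousGenerators.le_of_forall_exists_eq_sum_add (h : HomogeneousGenerators f ρ e)
    (hmin : ∀ (n : ℕ) (ρ : Fin n → Fin 3 → S) (e' : Fin n → ℕ),
      HomogeneousGenerators f ρ e' → m ≤ n)
    {n : ℕ} {τ : Fin n → Fin 3 → S} (hτ : ∀ i, τ i ∈ AR f) {ℓ : S} (hℓ : constantCoeff ℓ = 0)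
    (hgen : ∀ σ ∈ AR f, ∃ (c : Fin n → S) (σ' : Fin 3 → S),
      σ' ∈ AR f ∧ σ = ∑ i, c i • τ i + ℓ • σ') : m ≤ n := by
  choose B σ' hσ' hB using fun j => hgen (ρ j) (h.mem_AR j)
  choose A hA using fun i => h.exists_eq_sum (hτ i)
  choose D hD using fun j => h.exists_eq_sum (hσ' j)
  have hone : (1 : Matrix (Fin m) (Fin m) ℂ) =
      (Matrix.of B).map constantCoeff * (Matrix.of A).map constantCoeff := by
    rw [← Matrix.map_mul]
    ext j k
    have hrel : ∑ l, ((1 : Matrix (Fin m) (Fin m) S) j l - (Matrix.of B * Matrix.of A) j l -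
        ℓ * D j l) • ρ l = 0 := by
      simp only [sub_smul, Finset.sum_sub_distrib, mul_smul, ← Finset.smul_sum, hD]
      rw [sub_sub, sub_eq_zero]
      have h1 : ∑ l, (1 : Matrix (Fin m) (Fin m) S) j l • ρ l = ρ j := by
        simp [Matrix.one_apply, ite_smul]
      have h2 : ∑ l, (Matrix.of B * Matrix.of A) j l • ρ l = ∑ i, B j i • τ i := by
        simp_rw [Matrix.mul_apply, Finset.sum_smul, Matrix.of_apply, mul_smul, ← hA,
          Finset.smul_sum]
        exact Finset.sum_comm
      rw [h1, h2]
      exact hB j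
    have hz := h.constantCoeff_eq_zero hmin hrel k
    rw [map_sub, map_sub, map_mul, hℓ, zero_mul, sub_zero, sub_eq_zero] at hz
    rw [Matrix.map_apply, ← hz]
    simp [Matrix.one_apply, apply_ite constantCoeff]
  have hr := Matrix.rank_mul_le_left ((Matrix.of B).map (constantCoeff (σ := Fin 3) (R := ℂ)))
    ((Matrix.of A).map constantCoeff)
  rw [← hone, Matrix.rank_one, Fintype.card_fin] at hr
  exact hr.trans (Matrix.rank_le_width _)

end Generators

/-- If the three Koszul syzygies are multiples of one vector, the 2×2 minors of their matrix vanish;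
among these, up to sign, are the squares of the partial derivatives. -/
theorem pderiv_eq_zero_of_koszul_mem_span {f : S} {d : ℕ} (hf : f.IsHomogeneous d)
    {a : Fin 3 → S}
    (h : ∀ τ ∈ AR f, (∀ i, (τ i).IsHomogeneous (d - 1)) → ∃ c : S, τ = c • a) :
    (fun i => pderiv i f) = 0 := by
  have hd (i : Fin 3) : (pderiv i f).IsHomogeneous (d - 1) := hf.pderiv
  have h0 : (0 : S).IsHomogeneous (d - 1) := isHomogeneous_zero _ _ _
  obtain ⟨c₀, hc₀⟩ := h ![0, pderiv 2 f, -pderiv 1 f]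
    (by rw [mem_AR_iff]; simp; ring) (by
      intro i; fin_cases i; exacts [h0, hd 2, (hd 1).neg])
  obtain ⟨c₁, hc₁⟩ := h ![-pderiv 2 f, 0, pderiv 0 f]
    (by rw [mem_AR_iff]; simp; ring) (by
      intro i; fin_cases i; exacts [(hd 2).neg, h0, hd 0])
  obtain ⟨c₂, hc₂⟩ := h ![pderiv 1 f, -pderiv 0 f, 0]
    (by rw [mem_AR_iff]; simp; ring) (by
      intro i; fin_cases i; exacts [hd 1, (hd 0).neg, h0])
  have h₀a : (0 : S) = c₀ * a 0 := congrFun hc₀ 0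
  have h₀b : pderiv 2 f = c₀ * a 1 := congrFun hc₀ 1
  have h₀c : -pderiv 1 f = c₀ * a 2 := congrFun hc₀ 2
  have h₁a : -pderiv 2 f = c₁ * a 0 := congrFun hc₁ 0
  have h₁b : (0 : S) = c₁ * a 1 := congrFun hc₁ 1
  have h₁c : pderiv 0 f = c₁ * a 2 := congrFun hc₁ 2
  have h₂a : pderiv 1 f = c₂ * a 0 := congrFun hc₂ 0
  have h₂b : -pderiv 0 f = c₂ * a 1 := congrFun hc₂ 1
  have e0 : pderiv 0 f * pderiv 0 f = 0 := by
    linear_combination pderiv 0 f * h₁c - c₁ * a 2 * h₂b + c₂ * a 2 * h₁b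
  have e1 : pderiv 1 f * pderiv 1 f = 0 := by
    linear_combination pderiv 1 f * h₂a - c₂ * a 0 * h₀c + c₂ * a 2 * h₀a
  have e2 : pderiv 2 f * pderiv 2 f = 0 := by
    linear_combination pderiv 2 f * h₀b - c₀ * a 1 * h₁a + c₀ * a 0 * h₁b
  ext1 i
  fin_cases i
  exacts [mul_self_eq_zero.1 e0, mul_self_eq_zero.1 e1, mul_self_eq_zero.1 e2]

end PlaneCurve

/-! ### Bounds on the exponents and on the number of generators -/

namespace PlaneCurve

section Main

variable {f : S} {m d : ℕ} {ρ : Fin m → Fin 3 → S} {e : Fin m → ℕ}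

theorem HomogeneousGenerators.two_le (h : HomogeneousGenerators f ρ e) (hf : f.IsHomogeneous d)
    (hf0 : (fun i => pderiv i f) ≠ 0) : 2 ≤ m := by
  by_contra! hm
  refine hf0 (pderiv_eq_zero_of_koszul_mem_span hf
    (a := if h : 0 < m then ρ ⟨0, h⟩ else 0) fun τ hτ _ => ?_)
  obtain ⟨c, rfl⟩ := h.exists_eq_sum hτ
  interval_cases m
  · exact ⟨0, by simp⟩
  · exact ⟨c 0, by simp⟩

/-- Otherwise only `ρ k` could contribute in degree `d - 1`, making all Koszul syzygies its
multiples. -/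
theorem HomogeneousGenerators.exponent_le (h : HomogeneousGenerators f ρ e)
    (hf : f.IsHomogeneous d) (hf0 : (fun i => pderiv i f) ≠ 0) {k l : Fin m}
    (hl : ∀ j, j ≠ k → e l ≤ e j) : e l ≤ d - 1 := by
  by_contra! hlt
  refine hf0 (pderiv_eq_zero_of_koszul_mem_span hf (a := ρ k) fun τ hτ hhom => ?_)
  obtain ⟨c, rfl⟩ := h.exists_eq_sum hτ
  refine ⟨if e k ≤ d - 1 then homogeneousComponent (d - 1 - e k) (c k) else 0, funext fun i => ?_⟩
  rw [← homogeneousComponent_eq_self (hhom i), h.homogeneousComponent_sum,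
    Finset.sum_eq_single k]
  · rfl
  · intro j _ hj
    rw [if_neg (by have := hl j hj; omega), zero_mul]
  · simp

/-- If `h ∇f` is homogeneous of degree `n`, then `h` is homogeneous of degree `n - (d - 1)`. -/
theorem exists_isHomogeneous_of_smul_pderiv (hf : f.IsHomogeneous d)
    (hf0 : (fun i => pderiv i f) ≠ 0) {h : S} (h0 : h ≠ 0) {n : ℕ}
    (hn : ∀ i, (h * pderiv i f).IsHomogeneous n) :
    ∃ s, s + (d - 1) = n ∧ h.IsHomogeneous s := by
  obtain ⟨i, hi⟩ := Function.ne_iff.1 hf0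
  have h1 := homogeneousComponent_eq_self (hn i)
  rw [homogeneousComponent_mul_of_isHomogeneous hf.pderiv] at h1
  split_ifs at h1 with hle
  · refine ⟨n - (d - 1), by omega, ?_⟩
    rw [← mul_right_cancel₀ hi h1]
    exact homogeneousComponent_isHomogeneous _ _
  · exact absurd h1.symm (mul_ne_zero h0 hi)

theorem HomogeneousGenerators.card_add_le (h : HomogeneousGenerators f ρ e)
    (hmin : ∀ (n : ℕ) (ρ : Fin n → Fin 3 → S) (e' : Fin n → ℕ),
      HomogeneousGenerators f ρ e' → m ≤ n)
    (hf : f.IsHomogeneous d) (hf0 : (fun i => pderiv i f) ≠ 0)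
    (hprim : ∀ g, (∀ i, g ∣ pderiv i f) → IsUnit g) {k l : Fin m} (hkl : k ≠ l)
    (hk : ∀ j, e k ≤ e j) : m + (d - 1) ≤ e k + e l + 2 := by
  have hne {c : Fin m → S} {j : Fin m} (hcj : constantCoeff (c j) ≠ 0) :
      ∑ j, c j • ρ j ≠ 0 := fun hc => hcj (h.constantCoeff_eq_zero hmin hc j)
  have hρ0 : ρ k ≠ 0 := by
    have := hne (c := Pi.single k 1) (j := k) (by simp)
    simpa [Pi.single_apply, ite_smul] using this
  have hker : ∀ σ, ρ k ⨯₃ σ = 0 → ∃ c : S, σ = c • ρ k := fun σ hσ =>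
    exists_eq_smul_of_cross_eq_zero (fun g hg => h.isUnit_of_forall_dvd hk hρ0 hg) hρ0 hσ
  obtain ⟨w, hw⟩ := exists_cross_eq_smul hprim hf0 (h.mem_AR k) (h.mem_AR l)
  -- If `w = 0`, then `ρ l` is a multiple of `ρ k`, a relation with coefficient `1` at `l`, against
  -- minimality.
  have hw0 : w ≠ 0 := by
    rintro rfl
    obtain ⟨c, hc⟩ := hker (ρ l) (by rw [hw, zero_smul])
    refine hne (c := Pi.single l 1 - Pi.single k c) (j := l) (by simp [hkl.symm]) ?_
    simp [sub_smul, Finset.sum_sub_distrib, Pi.single_apply, ite_smul, ← hc]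
  have hhom (i : Fin 3) : (w * pderiv i f).IsHomogeneous (e k + e l) := by
    have h1 : w * pderiv i f = (ρ k ⨯₃ ρ l) i := by rw [hw]; rfl
    have h2 (a b : Fin 3) : (ρ k a * ρ l b).IsHomogeneous (e k + e l) :=
      (h.homogeneous k a).mul (h.homogeneous l b)
    rw [h1, cross_apply]
    fin_cases i
    exacts [(h2 _ _).sub (h2 _ _), (h2 _ _).sub (h2 _ _), (h2 _ _).sub (h2 _ _)]
  obtain ⟨s, hs, hwhom⟩ := exists_isHomogeneous_of_smul_pderiv hf hf0 hw0 hhom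
  have hwI : w ∈ crossIdeal f (ρ k) := ⟨ρ l, h.mem_AR l, hw⟩
  obtain ⟨v, ℓ, hvI, hℓ, hgen⟩ := exists_generators_modulo_linear_form hwI hwhom hw0
    fun _ => mem_crossIdeal_of_forall_X_mul_mem (h.mem_AR k) hρ0 hker
  choose τ hτ hτv using hvI
  -- The `s + 1` lifts of the generators modulo `ℓ`, and `ρ k` for the kernel.
  have hm : m ≤ s + 1 + 1 := by
    refine h.le_of_forall_exists_eq_sum_add hmin (τ := Fin.cons (ρ k) τ)
      (Fin.cases (h.mem_AR k) hτ) hℓ fun σ hσ => ?_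
    obtain ⟨u, hu⟩ := exists_cross_eq_smul hprim hf0 (h.mem_AR k) hσ
    obtain ⟨c, u', ⟨σ', hσ', hu'⟩, hc⟩ := hgen u ⟨σ, hσ, hu⟩
    obtain ⟨b, hb⟩ := hker (σ - (∑ i, c i • τ i + ℓ • σ')) <| by
      simp only [map_sub, map_add, map_sum, map_smul, hu, hτv, hu', hc]
      simp only [smul_smul, ← Finset.sum_smul, ← add_smul, sub_self]
    refine ⟨Fin.cons b c, σ', hσ', ?_⟩
    rw [Fin.sum_univ_succ]
    simp only [Fin.cons_zero, Fin.cons_succ]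
    rw [← hb]
    abel
  omega

end Main

end PlaneCurve

theorem proposition2p1 (d : ℕ) (hd : 3 ≤ d) (f : PlaneCurve.S) (hf : f.IsHomogeneous d)
    (hred : Squarefree f) (m : ℕ) (e : Fin m → ℕ) (hC : PlaneCurve.IsSyzygyCurve f m e)
    (he : ∀ j, 1 ≤ e j) :
    ∃ hm : 2 ≤ m,
      (m : ℤ) ≤ (e ⟨0, by omega⟩ : ℤ) + (e ⟨1, by omega⟩ : ℤ) - (d : ℤ) + 3 ∧
      (e ⟨0, by omega⟩ : ℤ) + (e ⟨1, by omega⟩ : ℤ) - (d : ℤ) + 3 ≤ (e ⟨0, by omega⟩ : ℤ) + 2 ∧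
      (e ⟨0, by omega⟩ : ℤ) + 2 ≤ (d : ℤ) + 1 := by
  obtain ⟨ρ, hρ⟩ := hC.generated
  have hprim (g : PlaneCurve.S) (hg : ∀ i, g ∣ pderiv i f) : IsUnit g :=
    isUnit_of_forall_dvd_pderiv (by omega) hf hred hg
  have hf0 : (fun i => pderiv i f) ≠ 0 := fun h0 =>
    not_isUnit_zero (hprim 0 fun i => by rw [congrFun h0 i]; rfl)
  have hm := hρ.two_le hf hf0
  have h1 := hρ.exponent_le hf hf0 (k := ⟨0, by omega⟩) (l := ⟨1, by omega⟩) fun j hj =>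
    hC.monotone (Fin.mk_le_of_le_val (Nat.one_le_iff_ne_zero.2 fun h => hj (Fin.ext h)))
  have h01 : e ⟨0, by omega⟩ ≤ e ⟨1, by omega⟩ := hC.monotone (by simp)
  have h2 := hρ.card_add_le hC.minimal hf hf0 hprim (k := ⟨0, by omega⟩) (l := ⟨1, by omega⟩)
    (by simp) fun j => hC.monotone (Fin.mk_le_of_le_val (Nat.zero_le _))
  refine ⟨hm, ?_, ?_, ?_⟩ <;> omega
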